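/- Let $n\ge 2$ and $\alpha\in[0,1]$, and consider the DQC1 state on $n+1$ qubits $$\rho^\alpha_n=\frac{1-\alpha}{2^n}\,|0\rangle\langle 0|\otimes \mathbb 1_n+\frac{\alpha}{2^{n+1}}\,\mathbb 1_{n+1},$$ where $|0\rangle\langle 0|$ acts on the first qubit and $\mathbb 1_m$ is the identity operator on $m$ qubits. A bipartition $\{A;B\}$ is a splitting of the set of $n+1$ qubits into two nonempty disjoint parties $A$ and $B$; it is a $\{k;n+1-k\}$ cut if one party has $k$ qubits and the other has the remaining $n+1-k$. A state $\rho$ is PPT from spectrum for $\{A;B\}$ if, for every unitary $U$ on the $n+1$ qubits, the partial transpose of $U\rho U^\dagger$ with respect to party $A$ is positive semidefinite. Then: 1. (Necessary condition.) If $\rho^\alpha_n$ is PPT from spectrum for every bipartition of the $n+1$ qubits, then $\alpha\ge 1-2^{-\lfloor n/2\rfloor}$. 2. (Sufficient condition.) If $\alpha\ge 1-2^{-\lfloor (n+1)/2\rfloor}$, then $\rho^\alpha_n$ is PPT from spectrum for every bipartition of the $n+1$ qubits. 3. For every integer $k$ with $1\le k<\frac{n+1}{2}$ and every $\{k;n+1-k\}$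 cut, $\rho^\alpha_n$ is PPT from spectrum for that cut if and only if $\alpha\ge 1-2^{-k}$. -/

import Mathlib

namespace DQC1

open scoped ComplexOrder Kronecker

/-- Labels of the computational basis of `N` qubits. -/
abbrev Qubits (N : ℕ) : Type := Fin N → Fin 2

/-- Operators on `N` qubits, as matrices in the computational basis. -/
abbrev Op (N : ℕ) : Type := Matrix (Qubits N) (Qubits N) ℂ

/-- The operator `A ⊗ B`, with `A` acting on the first qubit and `B` on the remaining `n`. -/
def firstTensor {n : ℕ} (A : Matrix (Fin 2) (Fin 2) ℂ) (B : Op n) : Op (n + 1) :=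
  Matrix.reindex (Fin.consEquiv fun _ => Fin 2) (Fin.consEquiv fun _ => Fin 2) (A ⊗ₖ B)

/-- The DQC1 state `(1 - α) / 2 ^ n |0⟩⟨0| ⊗ 𝟙 + α / 2 ^ (n + 1) 𝟙` on `n + 1` qubits. -/
noncomputable def dqc1State (n : ℕ) (α : ℝ) : Op (n + 1) :=
  (((1 - α) / 2 ^ n : ℝ) : ℂ) • firstTensor (Matrix.single 0 0 1) 1 +
    ((α / 2 ^ (n + 1) : ℝ) : ℂ) • (1 : Op (n + 1))

/-- Partial transpose on the qubits in `A`: the row and column labels of the qubits in `A`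
are exchanged, those of the other qubits are kept. -/
def partialTranspose {N : ℕ} (A : Finset (Fin N)) (M : Op N) : Op N :=
  Matrix.of fun x y => M (A.piecewise y x) (A.piecewise x y)

/-- Positive partial transpose with respect to the bipartition `{A; Aᶜ}`. -/
def IsPPT {N : ℕ} (A : Finset (Fin N)) (M : Op N) : Prop :=
  (partialTranspose A M).PosSemidef

/-- PPT from spectrum with respect to the bipartition `{A; Aᶜ}`. -/
def PPTFromSpectrum {N : ℕ} (A : Finset (Fin N)) (ρ : Op N) : Prop :=
  ∀ U ∈ Matrix.unitaryGroup (Qubits N) ℂ, IsPPT A (U * ρ * U.conjTranspose)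

/-- `{A; Aᶜ}` is a (nontrivial) bipartition of the `N` qubits: both parties are nonempty. -/
def IsBipartition {N : ℕ} (A : Finset (Fin N)) : Prop :=
  A.Nonempty ∧ Aᶜ.Nonempty

/-- `{A; Aᶜ}` is a `{k; N - k}` cut: one of the two parties has exactly `k` qubits. -/
def IsCut {N : ℕ} (k : ℕ) (A : Finset (Fin N)) : Prop :=
  A.card = k ∨ Aᶜ.card = k

end DQC1

/-! Since |0⟩⟨0| = (1 + Z)/2, every unitary conjugate of the state is, up to a positive factor, 1 +
(1 - α) S with S a Hermitian involution. Everything thus rests on how negative the partial transpose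
of S can be. Upper bound: it is at least -2^|A|, by a sum of squares
(`posSemidef_card_add_blockTranspose`), so 1 - 2^(-|A|) ≤ α suffices for any A. Sharpness: if 2|A| <
n + 1, take S = F Z_r, where F swaps A with a disjoint copy and r is a spare qubit. The partial
transpose of F is 2^|A| times a projector on the swapped pairs, and Z_r = -1 turns this into the
eigenvalue -2^|A|. `exists_unitary_conj_pauliZ` puts S in the unitary orbit of Z. -/

namespace DQC1

open scoped ComplexOrder
open Matrix

/-! ### Partial transposes of reflections: the lower bound -/

section Contraction

variable {α β : Type*} [Fintype α] [Fintype β] [DecidableEq α]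

/-- The vector `|a'⟩ ⊗ v_a`, where `v_a` is the `a`-th block of `v`. -/
def blockMove (v : α × β → ℂ) (a a' : α) : α × β → ℂ :=
  fun z => if z.1 = a' then v (a, z.2) else 0

lemma sum_blockMove_self (v : α × β → ℂ) :
    ∑ a, ∑ a', star (blockMove v a a') ⬝ᵥ blockMove v a a' =
      (Fintype.card α : ℂ) * (star v ⬝ᵥ v) := by
  simp only [dotProduct, blockMove, Fintype.sum_prod_type, Pi.star_apply]
  have h (a a' : α) : ∑ c : α, ∑ b : β,
      star (if c = a' then v (a, b) else 0) * (if c = a' then v (a, b) else 0) =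
      ∑ b, star (v (a, b)) * v (a, b) := by
    rw [Finset.sum_eq_single a'] <;> simp +contextual
  simp only [h, Finset.sum_const, Finset.card_univ, nsmul_eq_mul, Finset.mul_sum]

/-- Each term pairs v_a with v_{a'} through the block (a', a) of S, which is the block (a, a') of
its partial transpose. -/
lemma sum_blockMove_cross (S : Matrix (α × β) (α × β) ℂ) (v : α × β → ℂ) :
    ∑ a, ∑ a', star (blockMove v a a') ⬝ᵥ S *ᵥ blockMove v a' a =
      star v ⬝ᵥ (Matrix.of fun x y : α × β => S (y.1, x.2) (x.1, y.2)) *ᵥ v := by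
  simp only [dotProduct, mulVec, blockMove, Fintype.sum_prod_type, Pi.star_apply, Matrix.of_apply]
  have h (a a' : α) : ∑ c : α, ∑ b : β, star (if c = a' then v (a, b) else 0) *
        ∑ c' : α, ∑ b' : β, S (c, b) (c', b') * (if c' = a then v (a', b') else 0) =
      ∑ b, star (v (a, b)) * ∑ b', S (a', b) (a, b') * v (a', b') := by
    rw [Finset.sum_eq_single a']
    · refine Finset.sum_congr rfl fun b _ => ?_
      rw [Finset.sum_eq_single a] <;> simp +contextual
    · simp +contextual
    · simp
  simp only [h]
  refine Finset.sum_congr rfl fun a _ => ?_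
  rw [Finset.sum_comm]
  simp only [Finset.mul_sum]

/-- Partial transposition on a factor of dimension `d` maps a reflection to an operator bounded
below by `-d`. -/
theorem posSemidef_card_add_blockTranspose [DecidableEq β] {S : Matrix (α × β) (α × β) ℂ}
    (hS : S.IsHermitian) (hSS : S * S = 1) :
    ((Fintype.card α : ℂ) • (1 : Matrix (α × β) (α × β) ℂ) +
      Matrix.of fun x y : α × β => S (y.1, x.2) (x.1, y.2)).PosSemidef := by
  refine Matrix.PosSemidef.of_dotProduct_mulVec_nonneg ?_ fun v => ?_
  · refine Matrix.IsHermitian.add ?_ ?_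
    · simp [Matrix.IsHermitian, Matrix.conjTranspose_smul]
    · ext x y
      simpa using hS.apply _ _
  · have hadj (w w' : α × β → ℂ) : star (S *ᵥ w) ⬝ᵥ w' = star w ⬝ᵥ S *ᵥ w' := by
      rw [star_mulVec, hS.eq, dotProduct_mulVec]
    have hsq (w w' : α × β → ℂ) : star (w + S *ᵥ w') ⬝ᵥ (w + S *ᵥ w') =
        star w ⬝ᵥ w + star w' ⬝ᵥ w' + star w ⬝ᵥ S *ᵥ w' + star w' ⬝ᵥ S *ᵥ w := by
      simp only [star_add, add_dotProduct, dotProduct_add, hadj, mulVec_mulVec, hSS, one_mulVec]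
      ring
    -- These squares add up to twice the desired quadratic form: the norms give d‖v‖² twice, and the
    -- two cross terms agree after exchanging a and a'.
    have hpos : 0 ≤ ∑ a, ∑ a', star (blockMove v a a' + S *ᵥ blockMove v a' a) ⬝ᵥ
        (blockMove v a a' + S *ᵥ blockMove v a' a) :=
      Finset.sum_nonneg fun a _ => Finset.sum_nonneg fun a' _ => dotProduct_star_self_nonneg _
    simp only [hsq, Finset.sum_add_distrib] at hpos
    rw [Finset.sum_comm (f := fun a a' => star (blockMove v a' a) ⬝ᵥ blockMove v a' a),
      Finset.sum_comm (f := fun a a' => star (blockMove v a' a) ⬝ᵥ S *ᵥ blockMove v a a'),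
      sum_blockMove_self, sum_blockMove_cross] at hpos
    rw [add_mulVec, dotProduct_add, smul_mulVec, one_mulVec, dotProduct_smul, smul_eq_mul]
    generalize (Fintype.card α : ℂ) * (star v ⬝ᵥ v) = p at *
    generalize star v ⬝ᵥ _ *ᵥ v = q at *
    have h2 : p + q = (1 / 2 : ℂ) * (p + p + q + q) := by ring
    rw [h2]
    exact mul_nonneg (by positivity) hpos

end Contraction

/-! ### Partial transposition on sets of qubits -/

section PartialTranspose

variable {N : ℕ} (A : Finset (Fin N))

lemma piecewise_eq_piecewise_swap_iff {x y : Qubits N} :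
    A.piecewise y x = A.piecewise x y ↔ x = y := by
  refine ⟨fun h => funext fun b => ?_, fun h => by rw [h]⟩
  have := congrFun h b
  by_cases hb : b ∈ A <;> simp [hb] at this <;> simp [this]

lemma partialTranspose_one : partialTranspose A (1 : Op N) = 1 := by
  ext x y
  simp [partialTranspose, Matrix.one_apply, piecewise_eq_piecewise_swap_iff]

lemma partialTranspose_add (M M' : Op N) :
    partialTranspose A (M + M') = partialTranspose A M + partialTranspose A M' := rfl

lemma partialTranspose_smul (c : ℂ) (M : Op N) :
    partialTranspose A (c • M) = c • partialTranspose A M := rfl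

lemma partialTranspose_compl (M : Op N) :
    partialTranspose Aᶜ M = (partialTranspose A M)ᵀ := by
  ext x y
  simp [partialTranspose, Finset.piecewise_compl]

lemma isPPT_compl (M : Op N) : IsPPT Aᶜ M ↔ IsPPT A M := by
  rw [IsPPT, IsPPT, partialTranspose_compl, Matrix.posSemidef_transpose_iff]

lemma pptFromSpectrum_compl (ρ : Op N) : PPTFromSpectrum Aᶜ ρ ↔ PPTFromSpectrum A ρ := by
  simp only [PPTFromSpectrum, isPPT_compl]

theorem posSemidef_two_pow_add_partialTranspose {S : Op N}
    (hS : S.IsHermitian) (hSS : S * S = 1) :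
    (((2 : ℂ) ^ A.card) • (1 : Op N) + partialTranspose A S).PosSemidef := by
  let e := Equiv.piEquivPiSubtypeProd (fun b => b ∈ A) (fun _ : Fin N => Fin 2)
  have h := posSemidef_card_add_blockTranspose (S := S.submatrix e.symm e.symm)
    (hS.submatrix _) (by rw [Matrix.submatrix_mul_equiv, hSS, Matrix.submatrix_one_equiv])
  have h' := h.submatrix e
  convert h' using 1
  ext x y
  have hp (x y : Qubits N) : e.symm ((e x).1, (e y).2) = A.piecewise x y := by
    funext b
    by_cases hb : b ∈ A <;> simp [e, Equiv.piEquivPiSubtypeProd, hb]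
  simp [hp, partialTranspose, Matrix.one_apply]

end PartialTranspose

/-! ### The state as a perturbed identity, and sufficiency -/

section State

/-- The Pauli operator `Z` on qubit `r`. -/
def pauliZ {N : ℕ} (r : Fin N) : Op N :=
  Matrix.diagonal fun x => if x r = 0 then 1 else -1

lemma pauliZ_isHermitian {N : ℕ} (r : Fin N) : (pauliZ r).IsHermitian := by
  rw [pauliZ, Matrix.isHermitian_diagonal_iff]
  intro x
  by_cases h : x r = 0 <;> simp [h, isSelfAdjoint_iff]

lemma pauliZ_mul_self {N : ℕ} (r : Fin N) : pauliZ r * pauliZ r = 1 := by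
  rw [pauliZ, Matrix.diagonal_mul_diagonal, ← Matrix.diagonal_one]
  congr 1
  funext x
  by_cases h : x r = 0 <;> simp [h]

lemma dqc1State_eq (n : ℕ) (α : ℝ) : dqc1State n α =
    (((1 : ℝ) / 2 ^ (n + 1) : ℝ) : ℂ) • ((1 : Op (n + 1)) + ((1 - α : ℝ) : ℂ) • pauliZ 0) := by
  ext x y
  have hxy : x = y ↔ x 0 = y 0 ∧ Fin.tail x = Fin.tail y := by
    rw [← Fin.cons_self_tail x, ← Fin.cons_self_tail y, Fin.cons_inj]
    simp
  have hf : firstTensor (n := n) (Matrix.single 0 0 1) 1 x y =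
      if x = y ∧ x 0 = 0 then 1 else 0 := by
    have h0 : firstTensor (n := n) (Matrix.single 0 0 1) 1 x y =
      (Matrix.single 0 0 1 : Matrix (Fin 2) (Fin 2) ℂ) (x 0) (y 0) *
        (1 : Op n) (Fin.tail x) (Fin.tail y) := rfl
    rw [h0, Matrix.single_apply, Matrix.one_apply]
    simp only [hxy]
    clear h0
    by_cases h1 : x 0 = 0 <;> by_cases h2 : y 0 = 0 <;>
      by_cases h3 : Fin.tail x = Fin.tail y <;> simp_all [eq_comm]
  simp only [dqc1State, Matrix.add_apply, Matrix.smul_apply, hf, pauliZ, Matrix.diagonal_apply,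
    Matrix.one_apply, smul_eq_mul]
  by_cases h : x = y <;> by_cases h0 : x 0 = 0 <;> simp [h, h0] <;> try simp_all
  all_goals field_simp <;> ring

lemma conj_dqc1State {n : ℕ} (α : ℝ) {U : Op (n + 1)}
    (hU : U ∈ Matrix.unitaryGroup (Qubits (n + 1)) ℂ) :
    U * dqc1State n α * Uᴴ = (((1 : ℝ) / 2 ^ (n + 1) : ℝ) : ℂ) •
      ((1 : Op (n + 1)) + ((1 - α : ℝ) : ℂ) • (U * pauliZ 0 * Uᴴ)) := by
  have hUU : U * Uᴴ = 1 := Matrix.mem_unitaryGroup_iff.mp hU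
  rw [dqc1State_eq]
  simp only [Matrix.mul_smul, Matrix.smul_mul, Matrix.mul_add, Matrix.add_mul, Matrix.mul_one, hUU]

theorem pptFromSpectrum_of_le {n : ℕ} {α : ℝ} (hα1 : α ≤ 1) {A : Finset (Fin (n + 1))}
    (h : 1 - 1 / 2 ^ A.card ≤ α) : PPTFromSpectrum A (dqc1State n α) := by
  intro U hU
  have hUU : Uᴴ * U = 1 := Matrix.mem_unitaryGroup_iff'.mp hU
  have hUU' : U * Uᴴ = 1 := Matrix.mem_unitaryGroup_iff.mp hU
  have hS : (U * pauliZ 0 * Uᴴ).IsHermitian :=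
    Matrix.isHermitian_mul_mul_conjTranspose _ (pauliZ_isHermitian 0)
  have hSS : (U * pauliZ 0 * Uᴴ) * (U * pauliZ 0 * Uᴴ) = 1 := by
    calc _ = U * pauliZ 0 * (Uᴴ * U) * pauliZ 0 * Uᴴ := by simp only [Matrix.mul_assoc]
      _ = U * (pauliZ 0 * pauliZ 0) * Uᴴ := by rw [hUU]; simp only [Matrix.mul_assoc, Matrix.one_mul]
      _ = 1 := by rw [pauliZ_mul_self, Matrix.mul_one, hUU']
  have hP := posSemidef_two_pow_add_partialTranspose A hS hSS
  rw [IsPPT, conj_dqc1State α hU, partialTranspose_smul, partialTranspose_add,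
    partialTranspose_smul, partialTranspose_one]
  -- Both summands are positive: the second by the reflection bound, the first because its
  -- coefficient is the slack in the threshold.
  have hsplit : (1 : Op (n + 1)) + ((1 - α : ℝ) : ℂ) • partialTranspose A (U * pauliZ 0 * Uᴴ) =
      ((1 - (1 - α) * 2 ^ A.card : ℝ) : ℂ) • (1 : Op (n + 1)) + ((1 - α : ℝ) : ℂ) •
        (((2 : ℂ) ^ A.card) • (1 : Op (n + 1)) + partialTranspose A (U * pauliZ 0 * Uᴴ)) := by
    push_cast
    module
  have hle : (1 - α) * 2 ^ A.card ≤ 1 := by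
    rw [← le_div_iff₀ (by positivity)]
    linarith
  rw [hsplit]
  refine Matrix.PosSemidef.smul ?_ (Complex.zero_le_real.mpr (by positivity))
  exact (Matrix.PosSemidef.one.smul (Complex.zero_le_real.mpr (by linarith))).add
    (hP.smul (Complex.zero_le_real.mpr (by linarith)))

end State

/-! ### The extremal reflection, and necessity -/

section Witness

/-- If `f` and `x` are commuting involutions, then `(1 + f + x - f x) / 2` is an involution. -/
lemma involution_of_commute {R : Type*} [Ring R] [Algebra ℂ R] {f x : R}
    (hff : f * f = 1) (hxx : x * x = 1) (hfx : x * f = f * x) :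
    ((1 / 2 : ℂ) • (1 + f + x - f * x)) * ((1 / 2 : ℂ) • (1 + f + x - f * x)) = 1 := by
  have h1 : f * (f * x) = x := by rw [← mul_assoc, hff, one_mul]
  have h2 : x * (f * x) = f := by rw [← mul_assoc, hfx, mul_assoc, hxx, mul_one]
  have h3 : f * x * f = x := by rw [mul_assoc, hfx, h1]
  have h4 : f * x * x = f := by rw [mul_assoc, hxx, mul_one]
  have h5 : f * x * (f * x) = 1 := by rw [mul_assoc, h2, hff]
  rw [smul_mul_smul_comm]
  simp only [mul_add, add_mul, mul_sub, sub_mul, one_mul, mul_one, hff, hxx, hfx, h1, h2, h3, h4,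
    h5]
  module

/-- If moreover `z` commutes with `f` and anticommutes with `x`, then that involution conjugates `z`
to `f z`. -/
lemma involution_conj {R : Type*} [Ring R] [Algebra ℂ R] {f x z : R}
    (hff : f * f = 1) (hxx : x * x = 1) (hfx : x * f = f * x) (hfz : z * f = f * z)
    (hxz : z * x = -(x * z)) :
    ((1 / 2 : ℂ) • (1 + f + x - f * x)) * z * ((1 / 2 : ℂ) • (1 + f + x - f * x)) = f * z := by
  have key : ((1 / 2 : ℂ) • (1 + f + x - f * x)) * z =
      f * z * ((1 / 2 : ℂ) • (1 + f + x - f * x)) := by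
    have h1 : f * (f * z) = z := by rw [← mul_assoc, hff, one_mul]
    have h2 : f * (f * (x * z)) = x * z := by rw [← mul_assoc, hff, one_mul]
    have h3 : z * (f * x) = -(f * (x * z)) := by rw [← mul_assoc, hfz, mul_assoc, hxz, mul_neg]
    simp only [mul_smul_comm, smul_mul_assoc, mul_add, add_mul, mul_sub, sub_mul, one_mul, mul_one,
      mul_assoc, hfz, hxz, h1, h2, h3, mul_neg]
    module
  rw [key, mul_assoc, involution_of_commute hff hxx hfx, mul_one]

variable {N : ℕ}

/-- The operator permuting the computational basis by `σ`. -/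
def basisPerm (σ : Qubits N → Qubits N) : Op N := (1 : Op N).submatrix σ id

lemma basisPerm_apply (σ : Qubits N → Qubits N) (x y : Qubits N) :
    basisPerm σ x y = if σ x = y then 1 else 0 := by
  simp [basisPerm, Matrix.one_apply]

lemma basisPerm_mul (σ : Qubits N → Qubits N) (M : Op N) :
    basisPerm σ * M = M.submatrix σ id := by
  ext x y
  simp [Matrix.mul_apply, basisPerm_apply]

lemma basisPerm_mul_basisPerm (σ σ' : Qubits N → Qubits N) :
    basisPerm σ * basisPerm σ' = basisPerm (σ' ∘ σ) := by
  rw [basisPerm_mul]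
  rfl

lemma basisPerm_mul_self {σ : Qubits N → Qubits N} (hσ : Function.Involutive σ) :
    basisPerm σ * basisPerm σ = 1 := by
  rw [basisPerm_mul_basisPerm, hσ.comp_self]
  rfl

lemma basisPerm_isHermitian {σ : Qubits N → Qubits N} (hσ : Function.Involutive σ) :
    (basisPerm σ).IsHermitian := by
  ext x y
  have : σ y = x ↔ σ x = y := by rw [hσ.eq_iff, eq_comm]
  simp [basisPerm_apply, this, apply_ite]

lemma pauliZ_mul_basisPerm {σ : Qubits N → Qubits N} {r s : Fin N} (h : ∀ x, σ x s = x r) :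
    pauliZ r * basisPerm σ = basisPerm σ * pauliZ s := by
  rw [basisPerm_mul]
  ext x y
  simp only [pauliZ, Matrix.diagonal_mul, basisPerm_apply, Matrix.submatrix_apply,
    Matrix.diagonal_apply, id, h]
  split_ifs <;> simp

lemma pauliZ_mul_basisPerm_of_flip {σ : Qubits N → Qubits N} {r : Fin N}
    (h : ∀ x, σ x r = x r + 1) :
    pauliZ r * basisPerm σ = -(basisPerm σ * pauliZ r) := by
  rw [basisPerm_mul]
  ext x y
  have h2 : ∀ a : Fin 2, a + 1 = 0 ↔ ¬ a = 0 := by decide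
  simp only [pauliZ, Matrix.diagonal_mul, basisPerm_apply, Matrix.submatrix_apply, Matrix.neg_apply,
    Matrix.diagonal_apply, id, h, h2]
  split_ifs <;> simp_all

/-- The reflection `F Z_r`, with `F` a product of disjoint qubit swaps that fix the qubit `r`, is
unitarily equivalent to `Z` on any other qubit `s`. -/
theorem exists_unitary_conj_pauliZ {τ : Fin N → Fin N} (hτ : Function.Involutive τ) {r : Fin N}
    (hr : τ r = r) (s : Fin N) :
    ∃ U ∈ Matrix.unitaryGroup (Qubits N) ℂ,
      U * pauliZ s * Uᴴ = basisPerm (fun x => x ∘ τ) * pauliZ r := by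
  let f : Qubits N → Qubits N := fun x => x ∘ τ
  let g : Qubits N → Qubits N := fun x => Function.update x r (x r + 1)
  let w : Qubits N → Qubits N := fun x => x ∘ Equiv.swap r s
  have hf : Function.Involutive f := fun x => by
    simp only [f, Function.comp_assoc, hτ.comp_self, Function.comp_id]
  have h2 : ∀ a : Fin 2, a + 1 + 1 = a := by decide
  have hg : Function.Involutive g := fun x => by simp [g, h2]
  have hw : Function.Involutive w := fun x => by
    funext b
    simp [w]
  have hfg : g ∘ f = f ∘ g := by
    funext x b
    have : τ b = r ↔ b = r := by rw [hτ.eq_iff, hr, eq_comm]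
    by_cases hb : b = r <;> simp [f, g, this, hb, hr]
  have hff := basisPerm_mul_self hf
  have hgg := basisPerm_mul_self hg
  have hww := basisPerm_mul_self hw
  have hgf : basisPerm g * basisPerm f = basisPerm f * basisPerm g := by
    rw [basisPerm_mul_basisPerm, basisPerm_mul_basisPerm, hfg]
  have hzf : pauliZ r * basisPerm f = basisPerm f * pauliZ r :=
    pauliZ_mul_basisPerm fun x => by simp [f, hr]
  have hzg : pauliZ r * basisPerm g = -(basisPerm g * pauliZ r) :=
    pauliZ_mul_basisPerm_of_flip fun x => by simp [g]
  have hzw : pauliZ r * basisPerm w = basisPerm w * pauliZ s :=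
    pauliZ_mul_basisPerm fun x => by simp [w]
  -- A bit flip on r controlled by F: it is 1 where F = 1 and X_r where F = -1, so it changes the
  -- sign of Z_r exactly where F = -1.
  let V : Op N := (1 / 2 : ℂ) • (1 + basisPerm f + basisPerm g - basisPerm f * basisPerm g)
  have hVV : V * V = 1 := involution_of_commute hff hgg hgf
  have hVz : V * pauliZ r * V = basisPerm f * pauliZ r := involution_conj hff hgg hgf hzf hzg
  have hVH : Vᴴ = V := by
    simp only [V, Matrix.conjTranspose_smul, Matrix.conjTranspose_sub, Matrix.conjTranspose_add,
      Matrix.conjTranspose_mul, Matrix.conjTranspose_one, (basisPerm_isHermitian hf).eq,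
      (basisPerm_isHermitian hg).eq, hgf]
    simp
  have hH : (V * basisPerm w)ᴴ = basisPerm w * V := by
    rw [Matrix.conjTranspose_mul, hVH, (basisPerm_isHermitian hw).eq]
  refine ⟨V * basisPerm w, ?_, ?_⟩
  · rw [Matrix.mem_unitaryGroup_iff, Matrix.star_eq_conjTranspose, hH, Matrix.mul_assoc,
      ← Matrix.mul_assoc (basisPerm w), hww, Matrix.one_mul, hVV]
  · calc _ = V * (basisPerm w * pauliZ s) * (basisPerm w * V) := by
          rw [hH, Matrix.mul_assoc V]
      _ = V * pauliZ r * (basisPerm w * basisPerm w) * V := by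
          rw [← hzw]
          simp only [Matrix.mul_assoc]
      _ = _ := by rw [hww, Matrix.mul_one, hVz]

/-- The bit string that equals `u` on `A`, its mirror image on `τ A`, and `1` elsewhere. -/
def mirror (τ : Fin N → Fin N) (A : Finset (Fin N)) (u : A → Fin 2) : Qubits N := fun b =>
  if h : b ∈ A then u ⟨b, h⟩ else if h : τ b ∈ A then u ⟨τ b, h⟩ else 1

lemma mirror_injective (τ : Fin N → Fin N) (A : Finset (Fin N)) :
    Function.Injective (mirror τ A) := by
  intro u v h
  funext b
  simpa [mirror] using congrFun h b

/-- Partial transposition turns the row label into (v on A, u on τ A) and the column label into (u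
on A, v on τ A). The swap matches them for all u and v, and the default bit 1 of `mirror` at r
supplies the sign. -/
lemma partialTranspose_mirror {τ : Fin N → Fin N} (hτ : Function.Involutive τ)
    {A : Finset (Fin N)} (hA : ∀ b ∈ A, τ b ∉ A) {r : Fin N} (hr : τ r = r)
    (u v : A → Fin 2) :
    partialTranspose A (basisPerm (fun x => x ∘ τ) * pauliZ r) (mirror τ A u) (mirror τ A v) =
      -1 := by
  have hrA : r ∉ A := fun h => hA r h (by rwa [hr])
  have hperm : A.piecewise (mirror τ A v) (mirror τ A u) ∘ τ =
      A.piecewise (mirror τ A u) (mirror τ A v) := by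
    funext b
    by_cases hb : b ∈ A
    · simp [hb, hA b hb, mirror, hτ b]
    · by_cases hb' : τ b ∈ A <;> simp [hb, hb', mirror, hτ b]
  have h1 : mirror τ A v r = 1 := by simp [mirror, hrA, hr]
  rw [partialTranspose, Matrix.of_apply, basisPerm_mul, Matrix.submatrix_apply, hperm, id, pauliZ,
    Matrix.diagonal_apply_eq, Finset.piecewise_eq_of_notMem _ _ _ hrA, h1]
  simp

/-- A set containing less than half of the points can be moved off itself by an involution with a
fixed point. -/
lemma exists_involutive_move {A : Finset (Fin N)} (hA : 2 * A.card < N) :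
    ∃ τ : Fin N → Fin N, Function.Involutive τ ∧ (∀ b ∈ A, τ b ∉ A) ∧ ∃ r, τ r = r := by
  have hc : Aᶜ.card = N - A.card := by simp [Finset.card_compl]
  obtain ⟨B, hBA, hB⟩ := Finset.exists_subset_card_eq (s := Aᶜ) (n := A.card) (by omega)
  have hdisj : ∀ b ∈ B, b ∉ A := fun b hb => Finset.mem_compl.mp (hBA hb)
  obtain ⟨r, hr⟩ : ∃ r, r ∉ A ∪ B := by
    by_contra! h
    have h1 := Finset.card_union_le A B
    rw [Finset.eq_univ_of_forall h, Finset.card_univ, Fintype.card_fin] at h1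
    omega
  let e : A ≃ B := Finset.equivOfCardEq hB.symm
  let τ : Fin N → Fin N := fun b =>
    if h : b ∈ A then e ⟨b, h⟩ else if h : b ∈ B then e.symm ⟨b, h⟩ else b
  have hτA (b : Fin N) (h : b ∈ A) : τ b = e ⟨b, h⟩ := by simp [τ, h]
  have hτB (b : Fin N) (h : b ∈ B) : τ b = e.symm ⟨b, h⟩ := by simp [τ, h, hdisj b h]
  have hτC (b : Fin N) (h : b ∉ A) (h' : b ∉ B) : τ b = b := by simp [τ, h, h']
  refine ⟨τ, fun b => ?_, fun b hb => ?_, r, ?_⟩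
  · by_cases h : b ∈ A
    · rw [hτA b h, hτB _ (e ⟨b, h⟩).2]
      simp
    · by_cases h' : b ∈ B
      · rw [hτB b h', hτA _ (e.symm ⟨b, h'⟩).2]
        simp
      · rw [hτC b h h', hτC b h h']
  · rw [hτA b hb]
    exact hdisj _ (e ⟨b, hb⟩).2
  · rw [Finset.mem_union, not_or] at hr
    exact hτC r hr.1 hr.2

theorem le_of_pptFromSpectrum {n : ℕ} {α : ℝ} {A : Finset (Fin (n + 1))}
    (hA : 2 * A.card < n + 1) (h : PPTFromSpectrum A (dqc1State n α)) :
    1 - 1 / 2 ^ A.card ≤ α := by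
  obtain ⟨τ, hτ, hτA, r, hr⟩ := exists_involutive_move hA
  obtain ⟨U, hU, hUZ⟩ := exists_unitary_conj_pauliZ hτ hr 0
  have hP : (partialTranspose A _).PosSemidef := h U hU
  rw [conj_dqc1State α hU, hUZ, partialTranspose_smul, partialTranspose_add,
    partialTranspose_smul, partialTranspose_one] at hP
  -- On mirrored strings the matrix is proportional to 1 - (1 - α) J, with J the all-ones matrix of
  -- size 2^|A|; the constant vector is the top eigenvector of J.
  have hnn := (hP.submatrix (mirror τ A)).dotProduct_mulVec_nonneg (fun _ => 1)
  have hentry (u v : A → Fin 2) : ((((1 : ℝ) / 2 ^ (n + 1) : ℝ) : ℂ) • ((1 : Op (n + 1)) +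
      ((1 - α : ℝ) : ℂ) • partialTranspose A (basisPerm (fun x => x ∘ τ) * pauliZ r)))
        (mirror τ A u) (mirror τ A v) =
      (((1 / 2 ^ (n + 1) * ((if u = v then 1 else 0) - (1 - α)) : ℝ)) : ℂ) := by
    rw [Matrix.smul_apply, Matrix.add_apply, Matrix.smul_apply, partialTranspose_mirror hτ hτA hr,
      Matrix.one_apply]
    push_cast
    simp only [smul_eq_mul, (mirror_injective τ A).eq_iff]
    split_ifs <;> push_cast <;> ring
  have hsum : (0 : ℝ) ≤ ∑ u : A → Fin 2, ∑ v : A → Fin 2,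
      (1 / 2 ^ (n + 1) * ((if u = v then 1 else 0) - (1 - α))) := by
    rw [← Complex.zero_le_real]
    convert hnn using 1
    simp only [dotProduct, mulVec, Matrix.submatrix_apply, hentry, Pi.star_apply, star_one, one_mul,
      mul_one]
    push_cast
    rfl
  simp only [← Finset.mul_sum, Finset.sum_sub_distrib, Finset.sum_ite_eq, Finset.mem_univ, if_true,
    Finset.sum_const, Finset.card_univ, Fintype.card_fun, Fintype.card_fin, Fintype.card_coe,
    nsmul_eq_mul, Nat.cast_pow, Nat.cast_ofNat, mul_one] at hsum
  have h1 := nonneg_of_mul_nonneg_right hsum (by positivity)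
  have hd : (0 : ℝ) < 2 ^ A.card := by positivity
  have h2 : (0 : ℝ) ≤ 2 ^ A.card * (1 - (1 - α) * 2 ^ A.card) := by linarith
  have h3 := nonneg_of_mul_nonneg_right h2 hd
  have h4 : 1 - α ≤ 1 / 2 ^ A.card := by
    rw [le_div_iff₀ hd]
    linarith
  linarith

theorem pptFromSpectrum_iff_of_card {n : ℕ} {α : ℝ} (hα1 : α ≤ 1) {A : Finset (Fin (n + 1))}
    (hA : 2 * A.card < n + 1) :
    PPTFromSpectrum A (dqc1State n α) ↔ 1 - 1 / 2 ^ A.card ≤ α :=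
  ⟨le_of_pptFromSpectrum hA, pptFromSpectrum_of_le hα1⟩

theorem pptFromSpectrum_iff_of_isCut {n : ℕ} {α : ℝ} (hα1 : α ≤ 1) {k : ℕ} (hk : 2 * k < n + 1)
    {A : Finset (Fin (n + 1))} (hA : IsCut k A) :
    PPTFromSpectrum A (dqc1State n α) ↔ 1 - 1 / 2 ^ k ≤ α := by
  rcases hA with rfl | rfl
  · exact pptFromSpectrum_iff_of_card hα1 hk
  · rw [← pptFromSpectrum_compl, pptFromSpectrum_iff_of_card hα1 hk]

end Witness

end DQC1

theorem mainTheorem1 (n : ℕ) (hn : 2 ≤ n) (α : ℝ) (hα0 : 0 ≤ α) (hα1 : α ≤ 1) :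
    -- necessary condition
    ((∀ A : Finset (Fin (n + 1)), DQC1.IsBipartition A →
        DQC1.PPTFromSpectrum A (DQC1.dqc1State n α)) →
      α ≥ 1 - 1 / 2 ^ (n / 2)) ∧
    -- sufficient condition
    (α ≥ 1 - 1 / 2 ^ ((n + 1) / 2) →
      ∀ A : Finset (Fin (n + 1)), DQC1.IsBipartition A →
        DQC1.PPTFromSpectrum A (DQC1.dqc1State n α)) ∧
    -- exact threshold for every unbalanced cut
    (∀ k : ℕ, 1 ≤ k → (k : ℝ) < ((n : ℝ) + 1) / 2 →
      ∀ A : Finset (Fin (n + 1)), DQC1.IsCut k A →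
        (DQC1.PPTFromSpectrum A (DQC1.dqc1State n α) ↔ α ≥ 1 - 1 / 2 ^ k)) := by
  refine ⟨fun h => ?_, fun h A _ => ?_, fun k _ hk A hA => ?_⟩
  -- n / 2 is the largest party size that still leaves a spare qubit beside two disjoint copies.
  · obtain ⟨A, -, hA⟩ := Finset.exists_subset_card_eq
      (s := (Finset.univ : Finset (Fin (n + 1)))) (n := n / 2) (by simp; omega)
    refine (DQC1.pptFromSpectrum_iff_of_isCut hα1 (by omega) (Or.inl hA)).mp (h A ⟨?_, ?_⟩)
    · rw [← Finset.card_pos]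
      omega
    · rw [← Finset.card_pos, Finset.card_compl, Fintype.card_fin]
      omega
  · have hle {j : ℕ} (hj : j ≤ (n + 1) / 2) : 1 - 1 / 2 ^ j ≤ α := by
      have h1 : (1 : ℝ) / 2 ^ ((n + 1) / 2) ≤ 1 / 2 ^ j :=
        one_div_le_one_div_of_le (by positivity) (pow_le_pow_right₀ (by norm_num) hj)
      linarith
    -- The smaller party has at most (n + 1) / 2 qubits, and transposing either party gives the same
    -- condition.
    by_cases hA : A.card ≤ (n + 1) / 2
    · exact DQC1.pptFromSpectrum_of_le hα1 (hle hA)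
    · rw [← DQC1.pptFromSpectrum_compl]
      refine DQC1.pptFromSpectrum_of_le hα1 (hle ?_)
      rw [Finset.card_compl, Fintype.card_fin]
      omega
  · refine DQC1.pptFromSpectrum_iff_of_isCut hα1 ?_ hA
    have h1 : (2 : ℝ) * k < n + 1 := by linarith
    exact_mod_cast h1
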